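/- For a field $K$ and a finite group $G$, let $G$ act on the rational function field $K(x(g):g\in G)$ by $K$-automorphisms with $h\cdot x(g)=x(hg)$ for $g,h\in G$, and let $K(G)=K(x(g):g\in G)^G$ be the fixed field. Let $K$ be a field with $\operatorname{char}K=p>0$, and let $1\to\mathbb Z/p\mathbb Z\to\widetilde G\to G\to1$ be a group extension (a short exact sequence of groups) with $G$ finite. Then $K(\widetilde G)$ is rational over $K(G)$; that is, there is a $K$-embedding (an injective $K$-linear homomorphism of fields) $K(G)\hookrightarrow K(\widetilde G)$ such that $K(\widetilde G)$ is purely transcendental, of finite transcendence degree, over the image of $K(G)$. -/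

import Mathlib

/-- The rational function field `K(x(g) : g ∈ G)`. -/
abbrev RegularFunctionField (K G : Type*) [Field K] : Type _ :=
  FractionRing (MvPolynomial G K)

/-- The action of `G` on `K[x(g) : g ∈ G]` by `K`-automorphisms, `h • x(g) = x(hg)`. -/
noncomputable def regularPolyAction (K G : Type*) [Field K] [Group G] :
    G →* (MvPolynomial G K ≃ₐ[K] MvPolynomial G K) where
  toFun h := MvPolynomial.renameEquiv K (Equiv.mulLeft h)
  map_one' := by
    ext f : 1
    simp [MvPolynomial.renameEquiv, Equiv.Perm.coe_one]
  map_mul' a b := by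
    ext f : 1
    simp [MvPolynomial.renameEquiv, MvPolynomial.rename_rename, Equiv.Perm.coe_mul,
      AlgEquiv.mul_apply]

/-- The induced action of `G` on the function field `K(x(g) : g ∈ G)` by `K`-automorphisms. -/
noncomputable def regularAction (K G : Type*) [Field K] [Group G] :
    G →* (RegularFunctionField K G ≃ₐ[K] RegularFunctionField K G) :=
  (IsFractionRing.fieldEquivOfAlgEquivHom K (RegularFunctionField K G)).comp
    (regularPolyAction K G)

theorem regularAction_X (K G : Type*) [Field K] [Group G] (h g : G) :
    regularAction K G h (algebraMap (MvPolynomial G K) _ (MvPolynomial.X g)) =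
      algebraMap (MvPolynomial G K) _ (MvPolynomial.X (h * g)) := by
  simp [regularAction, regularPolyAction]

/-- The fixed field `K(G) = K(x(g) : g ∈ G)^G`. -/
noncomputable def noetherField (K G : Type*) [Field K] [Group G] :
    IntermediateField K (RegularFunctionField K G) :=
  IntermediateField.fixedField (regularAction K G).range

theorem mem_noetherField (K G : Type*) [Field K] [Group G] (f : RegularFunctionField K G) :
    f ∈ noetherField K G ↔ ∀ h : G, regularAction K G h f = f := by
  simp [noetherField, IntermediateField.mem_fixedField_iff]

/-- The field extension `L / F` is rational, that is, purely transcendental of finite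
transcendence degree: `L = F(x₁, …, xₙ)` with `x₁, …, xₙ` algebraically independent over `F`. -/
def IsRationalExtension (F L : Type*) [Field F] [Field L] [Algebra F L] : Prop :=
  ∃ (n : ℕ) (x : Fin n → L),
    AlgebraicIndependent F x ∧ IntermediateField.adjoin F (Set.range x) = ⊤

/-! Write `Γ` for the extension group, L for its function field, y_γ for the sum of the variables in
the fibre over γ ∈ G, and s for the sum of all variables. The y_γ give an equivariant copy K(y) of
the function field of G, hence an embedding of K(G) in K(Γ). By transcendence degree it is enough to
generate K(Γ) over K(G) by |Γ| - |G| elements; they are then automatically independent.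

Characteristic p makes elements of ℤ/p available as coefficients. This gives a linear form u
(`twistedForm`) that the kernel moves by ℤ/p-multiples of s, and Γ by a character modulo K(y). So w
= u^p - s^(p-1) u is fixed by the kernel, and averaging yields an invariant t = αw + β with α ≠ 0
and α, β in K(y) (`exists_traceForm_eq`). This t is the first generator, and u has degree at most p
over K(y)(t).

The field K(y, u) is stable under Γ, which acts faithfully on it, so by semilinear descent invariant
linear forms over it span all the variables (`regularVar_mem_span_traces`). Since the y_γ and u
already lie in the field, |Γ| - |G| - 1 invariant forms together with 1 suffice; these are the other
generators.

Let A be generated by K(G) and these elements. Then L = A·K(y)(u), so [L : A] ≤ |G| p = |Γ| = [L :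
K(Γ)]. As A ⊆ K(Γ), the two are equal (`subfield_le_of_finrank_mul_le`). -/

/-! ### Linear forms in the function field and the regular action -/

section LinearForms

open MvPolynomial

variable (K : Type*) {Γ : Type*} [Field K]

/-- The variable `x(g)` of the rational function field. -/
noncomputable def regularVar (g : Γ) : RegularFunctionField K Γ :=
  algebraMap (MvPolynomial Γ K) _ (X g)

/-- The linear form `∑ c(g) x(g)` in the polynomial ring. -/
noncomputable def polyLinForm [Fintype Γ] : (Γ → K) →ₗ[K] MvPolynomial Γ K :=
  Fintype.linearCombination K (fun g => X g)

/-- The linear form `∑ c(g) x(g)` in the rational function field. -/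
noncomputable def linForm [Fintype Γ] : (Γ → K) →ₗ[K] RegularFunctionField K Γ :=
  Fintype.linearCombination K (regularVar K)

variable {K}

theorem algebraMap_polyLinForm [Fintype Γ] (c : Γ → K) :
    algebraMap _ (RegularFunctionField K Γ) (polyLinForm K c) = linForm K c := by
  simp only [polyLinForm, linForm, Fintype.linearCombination_apply, regularVar, map_sum]
  refine Finset.sum_congr rfl fun g _ => ?_
  rw [Algebra.smul_def, Algebra.smul_def, map_mul, ← IsScalarTower.algebraMap_apply]

theorem linForm_apply [Fintype Γ] (c : Γ → K) :
    linForm K c = ∑ g, c g • regularVar K g := rfl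

theorem polyLinForm_injective [Fintype Γ] : Function.Injective (polyLinForm K (Γ := Γ)) := by
  classical
  have h : LinearIndependent K (fun g : Γ => (X g : MvPolynomial Γ K)) :=
    MvPolynomial.linearIndependent_X Γ K
  exact linearIndependent_iff_injective_fintypeLinearCombination.mp h

theorem linForm_injective [Fintype Γ] : Function.Injective (linForm K (Γ := Γ)) := by
  intro c d h
  rw [← algebraMap_polyLinForm, ← algebraMap_polyLinForm] at h
  exact polyLinForm_injective (IsFractionRing.injective _ _ h)

theorem linForm_ne_zero [Fintype Γ] {c : Γ → K} (g : Γ) (h : c g ≠ 0) : linForm K c ≠ 0 := by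
  intro h0
  rw [← map_zero (linForm K (Γ := Γ))] at h0
  exact h (congrFun (linForm_injective h0) g)

theorem polyLinForm_isHomogeneous [Fintype Γ] (c : Γ → K) : (polyLinForm K c).IsHomogeneous 1 := by
  refine IsHomogeneous.sum _ _ _ fun g _ => ?_
  rw [MvPolynomial.smul_eq_C_mul]
  exact isHomogeneous_C_mul_X _ _

/-- Comparing the components of degree `1` and `2`. -/
theorem linForm_sq_add_linForm_inj [Fintype Γ] {c c' d d' : Γ → K}
    (h : linForm K c ^ 2 + linForm K d = linForm K c' ^ 2 + linForm K d') :
    (c = c' ∨ c = -c') ∧ d = d' := by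
  simp only [← algebraMap_polyLinForm, ← map_pow, ← map_add] at h
  replace h := IsFractionRing.injective _ _ h
  have h2 (c : Γ → K) : polyLinForm K c ^ 2 ∈ homogeneousSubmodule Γ K 2 :=
    (polyLinForm_isHomogeneous c).pow 2
  have h1 (c : Γ → K) : polyLinForm K c ∈ homogeneousSubmodule Γ K 1 :=
    polyLinForm_isHomogeneous c
  have e1 := congrArg (homogeneousComponent 1) h
  simp only [map_add, homogeneousComponent_of_mem (h2 _), homogeneousComponent_of_mem (h1 _)] at e1
  have hd : d = d' := polyLinForm_injective (by simpa using e1)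
  subst hd
  refine ⟨?_, rfl⟩
  rcases sq_eq_sq_iff_eq_or_eq_neg.mp (add_right_cancel h) with h | h
  · exact Or.inl (polyLinForm_injective h)
  · rw [← map_neg] at h
    exact Or.inr (polyLinForm_injective h)

theorem regularVar_injective : Function.Injective (regularVar K (Γ := Γ)) :=
  (IsFractionRing.injective (MvPolynomial Γ K) (RegularFunctionField K Γ)).comp
    (MvPolynomial.X_injective)

theorem adjoin_regularVar : IntermediateField.adjoin K (Set.range (regularVar K (Γ := Γ))) = ⊤ := by
  rw [eq_top_iff]
  intro f _
  obtain ⟨a, b, -, rfl⟩ := IsFractionRing.div_surjective (A := MvPolynomial Γ K) f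
  have key (a : MvPolynomial Γ K) : algebraMap _ (RegularFunctionField K Γ) a ∈
      IntermediateField.adjoin K (Set.range (regularVar K (Γ := Γ))) := by
    induction a using MvPolynomial.induction_on with
    | C r =>
      rw [← MvPolynomial.algebraMap_eq, ← IsScalarTower.algebraMap_apply]
      exact IntermediateField.algebraMap_mem _ _
    | add p q hp hq => rw [map_add]; exact add_mem hp hq
    | mul_X p n hp =>
      rw [map_mul]
      exact mul_mem hp (IntermediateField.subset_adjoin _ _ ⟨n, rfl⟩)
  exact div_mem (key a) (key b)

theorem trdeg_regularFunctionField [Finite Γ] :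
    Algebra.trdeg K (RegularFunctionField K Γ) = Nat.card Γ := by
  have : Algebra.IsAlgebraic (MvPolynomial Γ K) (RegularFunctionField K Γ) :=
    IsLocalization.isAlgebraic _ (nonZeroDivisors (MvPolynomial Γ K))
  have h := ((IsTranscendenceBasis.mvPolynomial Γ K).algebraMap_comp
    (A := RegularFunctionField K Γ)).lift_cardinalMk_eq_trdeg
  rw [← Nat.cast_card, Cardinal.lift_natCast] at h
  simpa using h.symm

variable [Group Γ]

theorem regularAction_regularVar (σ g : Γ) :
    regularAction K Γ σ (regularVar K g) = regularVar K (σ * g) :=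
  regularAction_X K Γ σ g

theorem regularAction_linForm [Fintype Γ] (σ : Γ) (c : Γ → K) :
    regularAction K Γ σ (linForm K c) = linForm K (fun g => c (σ⁻¹ * g)) := by
  simp only [linForm_apply, map_sum, map_smul, regularAction_regularVar]
  exact Fintype.sum_equiv (Equiv.mulLeft σ) _ _ (by simp)

theorem regularAction_injective : Function.Injective (regularAction K Γ) := by
  intro σ τ h
  have := congrArg (fun f => f (regularVar K 1)) h
  simpa [regularAction_regularVar, regularVar_injective.eq_iff] using this

theorem sum_regularAction_mem [Fintype Γ] (f : RegularFunctionField K Γ) :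
    ∑ σ, regularAction K Γ σ f ∈ noetherField K Γ := by
  rw [mem_noetherField]
  intro h
  rw [map_sum]
  refine Fintype.sum_equiv (Equiv.mulLeft h) _ _ (fun σ => ?_)
  simp [AlgEquiv.mul_apply]

/-- Artin's theorem, the regular action being faithful. -/
theorem finrank_noetherField [Fintype Γ] :
    Module.finrank (noetherField K Γ) (RegularFunctionField K Γ) = Fintype.card Γ := by
  classical
  have : Finite (regularAction K Γ).range := Set.finite_range (regularAction K Γ)
  have := Fintype.ofFinite (regularAction K Γ).range
  have h := FixedPoints.finrank_eq_card (regularAction K Γ).range (RegularFunctionField K Γ)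
  rw [← Nat.card_eq_fintype_card, ← Nat.card_congr
    (MonoidHom.ofInjective regularAction_injective).toEquiv, Nat.card_eq_fintype_card] at h
  exact h

instance finiteDimensional_noetherField [Finite Γ] :
    FiniteDimensional (noetherField K Γ) (RegularFunctionField K Γ) := by
  have := Fintype.ofFinite Γ
  refine FiniteDimensional.of_finrank_pos ?_
  rw [finrank_noetherField]
  exact Fintype.card_pos

end LinearForms

/-! ### Extensions by ℤ/p: conjugation character and fibre coordinate -/

section CyclicKernel

variable {p : ℕ} {G Γ : Type*} [Group G] [Group Γ]
  (S : GroupExtension (Multiplicative (ZMod p)) Γ G)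

/-- An automorphism of `ℤ/p` is a multiplication. -/
theorem toAdd_mulAut_zmod_apply (f : MulAut (Multiplicative (ZMod p))) (k : ZMod p) :
    (f (Multiplicative.ofAdd k)).toAdd = (f (Multiplicative.ofAdd 1)).toAdd * k := by
  let φ : ZMod p →+ ZMod p := AddMonoidHom.toMultiplicative.symm f.toMonoidHom
  have h := (φ.toZModLinearMap p).map_smul k 1
  rw [smul_eq_mul, mul_one, smul_eq_mul, mul_comm] at h
  exact h

namespace GroupExtension

/-- The inclusion of the kernel, written additively. -/
def inlAdd (k : ZMod p) : Γ := S.inl (Multiplicative.ofAdd k)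

theorem inlAdd_add (k l : ZMod p) : S.inlAdd (k + l) = S.inlAdd k * S.inlAdd l := by
  simp [inlAdd]

theorem inlAdd_injective : Function.Injective S.inlAdd :=
  S.inl_injective.comp Multiplicative.ofAdd.injective

@[simp] theorem rightHom_inlAdd (k : ZMod p) : S.rightHom (S.inlAdd k) = 1 :=
  S.rightHom_inl _

theorem rightHom_eq_iff {g h : Γ} : S.rightHom g = S.rightHom h ↔ ∃ k, h = g * S.inlAdd k := by
  constructor
  · intro e
    have : g⁻¹ * h ∈ S.rightHom.ker := by simp [MonoidHom.mem_ker, e]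
    rw [← S.range_inl_eq_ker_rightHom] at this
    obtain ⟨k, hk⟩ := this
    exact ⟨k.toAdd, by simp [inlAdd, hk]⟩
  · rintro ⟨k, rfl⟩
    simp

/-- The character describing the conjugation action on the kernel. -/
noncomputable def conjChar : Γ →* ZMod p where
  toFun g := (S.conjAct g (Multiplicative.ofAdd 1)).toAdd
  map_one' := by simp
  map_mul' g h := by
    rw [map_mul, MulAut.mul_apply]
    exact toAdd_mulAut_zmod_apply (S.conjAct g) _

theorem mul_inlAdd (g : Γ) (k : ZMod p) :
    g * S.inlAdd k = S.inlAdd (S.conjChar g * k) * g := by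
  have h : S.conjAct g (Multiplicative.ofAdd k) = Multiplicative.ofAdd (S.conjChar g * k) :=
    toAdd_mulAut_zmod_apply (S.conjAct g) k
  rw [inlAdd, inlAdd, ← h, inl_conjAct_comm, inv_mul_cancel_right]

theorem conjChar_ne_zero [Nontrivial (ZMod p)] (g : Γ) : S.conjChar g ≠ 0 := by
  intro h
  have := map_mul S.conjChar g g⁻¹
  rw [h, mul_inv_cancel, map_one, zero_mul] at this
  exact one_ne_zero this

theorem conjChar_inv [Fact p.Prime] (g : Γ) : S.conjChar g⁻¹ = (S.conjChar g)⁻¹ := by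
  refine eq_inv_of_mul_eq_one_left ?_
  rw [← map_mul, inv_mul_cancel, map_one]

/-- The kernel is abelian; hence the character is constant on fibres. -/
theorem conjChar_inlAdd (k : ZMod p) : S.conjChar (S.inlAdd k) = 1 := by
  have h := S.mul_inlAdd (S.inlAdd k) 1
  rw [← inlAdd_add, ← inlAdd_add, S.inlAdd_injective.eq_iff, add_comm] at h
  simpa using (add_right_cancel h).symm

@[simp] theorem conjChar_mul_inlAdd (g : Γ) (k : ZMod p) :
    S.conjChar (g * S.inlAdd k) = S.conjChar g := by
  rw [map_mul, conjChar_inlAdd, mul_one]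

theorem exists_eq_mul_inlAdd (g : Γ) :
    ∃ k, g = Function.surjInv S.rightHom_surjective (S.rightHom g) * S.inlAdd k :=
  S.rightHom_eq_iff.mp (Function.surjInv_eq S.rightHom_surjective _)

/-- The coordinate of an element along its fibre over the quotient, with respect to a section. -/
noncomputable def fiberIndex (g : Γ) : ZMod p := (S.exists_eq_mul_inlAdd g).choose

theorem eq_mul_fiberIndex (g : Γ) :
    g = Function.surjInv S.rightHom_surjective (S.rightHom g) * S.inlAdd (S.fiberIndex g) :=
  (S.exists_eq_mul_inlAdd g).choose_spec

@[simp] theorem fiberIndex_mul_inlAdd (g : Γ) (k : ZMod p) :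
    S.fiberIndex (g * S.inlAdd k) = S.fiberIndex g + k := by
  have h := S.eq_mul_fiberIndex (g * S.inlAdd k)
  conv_lhs at h => rw [S.eq_mul_fiberIndex g]
  rw [map_mul, rightHom_inlAdd, mul_one, mul_assoc, mul_right_inj, ← inlAdd_add] at h
  exact (S.inlAdd_injective h).symm

theorem exists_rightHom_fiberIndex (γ : G) (k : ZMod p) :
    ∃ g, S.rightHom g = γ ∧ S.fiberIndex g = k := by
  obtain ⟨g, rfl⟩ := S.rightHom_surjective γ
  exact ⟨g * S.inlAdd (k - S.fiberIndex g), by simp, by simp⟩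

theorem eq_of_rightHom_fiberIndex {g h : Γ} (h1 : S.rightHom g = S.rightHom h)
    (h2 : S.fiberIndex g = S.fiberIndex h) : g = h := by
  rw [S.eq_mul_fiberIndex g, S.eq_mul_fiberIndex h, h1, h2]

theorem card_eq_mul (S : GroupExtension (Multiplicative (ZMod p)) Γ G)
    [Fintype Γ] [Fintype G] : Fintype.card Γ = Fintype.card G * p := by
  have h : Function.Bijective (fun g => (S.rightHom g, S.fiberIndex g)) := by
    constructor
    · intro g h e
      exact S.eq_of_rightHom_fiberIndex (Prod.ext_iff.mp e).1 (Prod.ext_iff.mp e).2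
    · rintro ⟨γ, k⟩
      obtain ⟨g, h1, h2⟩ := S.exists_rightHom_fiberIndex γ k
      exact ⟨g, by simp [h1, h2]⟩
  rw [← Nat.card_eq_fintype_card, Nat.card_congr (Equiv.ofBijective _ h), Nat.card_prod]
  simp

end GroupExtension

end CyclicKernel

/-! ### Fibre sums, the twisted form and the invariant built from it -/

section InvariantForms

variable {p : ℕ} {G Γ : Type*} [Group G] [Group Γ] [Fintype Γ]
  (S : GroupExtension (Multiplicative (ZMod p)) Γ G) (K : Type*) [Field K]

open Classical in
/-- The sum of the variables in a fibre of the extension. -/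
noncomputable def fiberForm (γ : G) : RegularFunctionField K Γ :=
  linForm K (fun g => if S.rightHom g = γ then 1 else 0)

/-- The subfield generated by the fibre sums. -/
noncomputable def fiberField : IntermediateField K (RegularFunctionField K Γ) :=
  IntermediateField.adjoin K (Set.range (fiberForm S K))

variable {K}

theorem fiberForm_mem_fiberField (γ : G) : fiberForm S K γ ∈ fiberField S K :=
  IntermediateField.subset_adjoin _ _ ⟨γ, rfl⟩

theorem linForm_comp_rightHom [Fintype G] (d : G → K) :
    linForm K (fun g => d (S.rightHom g)) = ∑ γ, d γ • fiberForm S K γ := by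
  classical
  simp only [fiberForm, ← map_smul, ← map_sum]
  congr 1
  ext g
  simp [Finset.sum_apply]

theorem linForm_mem_fiberField {c : Γ → K} (hc : ∀ g k, c (g * S.inlAdd k) = c g) :
    linForm K c ∈ fiberField S K := by
  have : Finite G := Finite.of_surjective _ S.rightHom_surjective
  have := Fintype.ofFinite G
  have : c = fun g => c (Function.surjInv S.rightHom_surjective (S.rightHom g)) := by
    ext g
    conv_lhs => rw [S.eq_mul_fiberIndex g, hc]
  rw [this, linForm_comp_rightHom S
    (fun γ => c (Function.surjInv S.rightHom_surjective γ))]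
  exact sum_mem fun γ _ => IntermediateField.smul_mem _ (fiberForm_mem_fiberField S γ)

theorem linForm_one_mem_fiberField : linForm K 1 ∈ fiberField S K :=
  linForm_mem_fiberField S (fun _ _ => rfl)

theorem sum_regularVar_mul_comp [Fintype G] (f : G → RegularFunctionField K Γ) :
    ∑ g, regularVar K g * f (S.rightHom g) = ∑ γ, fiberForm S K γ * f γ := by
  classical
  simp only [fiberForm, linForm_apply, Finset.sum_mul]
  rw [Finset.sum_comm]
  refine Finset.sum_congr rfl fun g _ => ?_
  rw [Finset.sum_eq_single (S.rightHom g)]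
  · simp
  · intro γ _ h
    simp [h.symm]
  · simp

theorem regularAction_fiberForm (σ : Γ) (γ : G) :
    regularAction K Γ σ (fiberForm S K γ) = fiberForm S K (S.rightHom σ * γ) := by
  rw [fiberForm, regularAction_linForm, fiberForm]
  congr 1
  ext g
  have h : S.rightHom (σ⁻¹ * g) = γ ↔ S.rightHom g = S.rightHom σ * γ := by
    rw [map_mul, map_inv, inv_mul_eq_iff_eq_mul]
  split_ifs <;> first | rfl | (exfalso; tauto)

theorem regularAction_mem_fiberField (σ : Γ) {f : RegularFunctionField K Γ}
    (hf : f ∈ fiberField S K) : regularAction K Γ σ f ∈ fiberField S K := by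
  have : fiberField S K ≤ (fiberField S K).comap (regularAction K Γ σ : _ →ₐ[K] _) := by
    refine IntermediateField.adjoin_le_iff.mpr ?_
    rintro _ ⟨γ, rfl⟩
    change regularAction K Γ σ _ ∈ fiberField S K
    rw [regularAction_fiberForm]
    exact fiberForm_mem_fiberField S _
  exact this hf

variable [CharP K p] [Fact p.Prime]

variable (K) in
/-- A linear form on which the kernel acts by translations along the sum of all variables. -/
noncomputable def twistedForm : RegularFunctionField K Γ :=
  linForm K (fun g => ZMod.castHom dvd_rfl K (S.conjChar g * S.fiberIndex g))

/-- Right translation by the kernel shifts the fibre coordinates of g and σ⁻¹g equally, so their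
difference is constant on fibres and contributes only fibre sums. -/
theorem regularAction_twistedForm (σ : Γ) :
    ∃ m ∈ fiberField S K, regularAction K Γ σ (twistedForm S K) =
      ZMod.castHom dvd_rfl K (S.conjChar σ)⁻¹ • twistedForm S K + m := by
  refine ⟨_, linForm_mem_fiberField S (c := fun g => ZMod.castHom dvd_rfl K
    (S.conjChar (σ⁻¹ * g) * (S.fiberIndex (σ⁻¹ * g) - S.fiberIndex g))) ?_, ?_⟩
  · intro g k
    rw [← mul_assoc]
    simp only [S.conjChar_mul_inlAdd, S.fiberIndex_mul_inlAdd]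
    congr 2
    ring
  · rw [twistedForm, regularAction_linForm, ← map_smul, ← map_add]
    congr 1
    ext g
    simp only [Pi.add_apply, Pi.smul_apply, smul_eq_mul, ← map_mul, ← map_add]
    congr 1
    rw [map_mul, S.conjChar_inv]
    ring

/-- Moving k across g divides it by the character of g; the factor `S.conjChar g` in the form
cancels this, so every coefficient drops by the same k. -/
theorem regularAction_inlAdd_twistedForm (k : ZMod p) :
    regularAction K Γ (S.inlAdd k) (twistedForm S K) =
      twistedForm S K - ZMod.castHom dvd_rfl K k • linForm K (1 : Γ → K) := by
  rw [twistedForm, regularAction_linForm, ← map_smul, ← map_sub]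
  congr 1
  ext g
  have h : (S.inlAdd k)⁻¹ * g = g * S.inlAdd (-((S.conjChar g)⁻¹ * k)) := by
    rw [inv_mul_eq_iff_eq_mul, S.mul_inlAdd, ← mul_assoc, ← S.inlAdd_add]
    have : k + S.conjChar g * -((S.conjChar g)⁻¹ * k) = 0 := by
      have := S.conjChar_ne_zero g
      field_simp
      ring
    rw [this]
    simp [GroupExtension.inlAdd]
  rw [h]
  simp only [S.conjChar_mul_inlAdd, S.fiberIndex_mul_inlAdd, Pi.sub_apply, Pi.smul_apply,
    Pi.one_apply, smul_eq_mul, mul_one, ← map_sub]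
  congr 1
  have := S.conjChar_ne_zero g
  field_simp
  ring

theorem regularAction_linForm_one (σ : Γ) :
    regularAction K Γ σ (linForm K 1) = linForm K 1 := by
  rw [regularAction_linForm]
  rfl

variable (K) in
/-- The Artin–Schreier form of the twisted form. -/
noncomputable def artinSchreierForm : RegularFunctionField K Γ :=
  twistedForm S K ^ p - linForm K 1 ^ (p - 1) * twistedForm S K

theorem castHom_pow (k : ZMod p) : ZMod.castHom dvd_rfl K k ^ p = ZMod.castHom dvd_rfl K k := by
  rw [← map_pow, ZMod.pow_card]

/-- With s the sum of all variables, f ↦ f^p - s^(p-1) f is ℤ/p-linear and commutes with Γ, so the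
transformation law of the twisted form carries over. -/
theorem regularAction_artinSchreierForm (σ : Γ) :
    ∃ m ∈ fiberField S K, regularAction K Γ σ (artinSchreierForm S K) =
      ZMod.castHom dvd_rfl K (S.conjChar σ)⁻¹ • artinSchreierForm S K + m := by
  obtain ⟨m, hm, h⟩ := regularAction_twistedForm S (K := K) σ
  refine ⟨m ^ p - linForm K 1 ^ (p - 1) * m, sub_mem (pow_mem hm _)
    (mul_mem (pow_mem (linForm_one_mem_fiberField S) _) hm), ?_⟩
  have : CharP (RegularFunctionField K Γ) p := charP_of_injective_algebraMap
    (algebraMap K (RegularFunctionField K Γ)).injective p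
  rw [artinSchreierForm, map_sub, map_mul, map_pow, map_pow, regularAction_linForm_one, h,
    add_pow_char, smul_pow, castHom_pow, smul_sub, mul_add, mul_smul_comm]
  ring

theorem regularAction_inlAdd_artinSchreierForm (k : ZMod p) :
    regularAction K Γ (S.inlAdd k) (artinSchreierForm S K) = artinSchreierForm S K := by
  have : CharP (RegularFunctionField K Γ) p := charP_of_injective_algebraMap
    (algebraMap K (RegularFunctionField K Γ)).injective p
  rw [artinSchreierForm, map_sub, map_mul, map_pow, map_pow, regularAction_linForm_one,
    regularAction_inlAdd_twistedForm, sub_pow_char, smul_pow, castHom_pow, mul_sub, mul_smul_comm,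
    ← pow_succ, Nat.sub_add_cancel (Fact.out : p.Prime).one_le]
  ring

variable (K) in
/-- The trace of the product of a variable and the Artin–Schreier form. -/
noncomputable def traceForm : RegularFunctionField K Γ :=
  ∑ σ, regularAction K Γ σ (regularVar K 1 * artinSchreierForm S K)

theorem traceForm_mem : traceForm S K ∈ noetherField K Γ := sum_regularAction_mem _

/-- Expand the trace by the transformation law of the Artin–Schreier form. Kernel invariance lets
the correction terms be chosen once per fibre, so the constant term involves the variables only
through fibre sums. -/
theorem exists_traceForm_eq :
    ∃ α ∈ fiberField S K, ∃ β ∈ fiberField S K, α ≠ 0 ∧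
      traceForm S K = α * artinSchreierForm S K + β := by
  have : Finite G := Finite.of_surjective _ S.rightHom_surjective
  have := Fintype.ofFinite G
  let r : G → Γ := Function.surjInv S.rightHom_surjective
  choose m hm h using regularAction_artinSchreierForm S (K := K)
  have hr (σ : Γ) : regularAction K Γ σ (artinSchreierForm S K) =
      regularAction K Γ (r (S.rightHom σ)) (artinSchreierForm S K) := by
    conv_lhs => rw [S.eq_mul_fiberIndex σ]
    rw [map_mul, AlgEquiv.mul_apply, regularAction_inlAdd_artinSchreierForm]
  refine ⟨linForm K (fun g => ZMod.castHom dvd_rfl K (S.conjChar g)⁻¹),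
    linForm_mem_fiberField S (fun g k => by simp), ∑ γ, fiberForm S K γ * m (r γ),
    sum_mem fun γ _ => mul_mem (fiberForm_mem_fiberField S γ) (hm _), ?_, ?_⟩
  · exact linForm_ne_zero 1 (by simp)
  · rw [traceForm, ← sum_regularVar_mul_comp S (fun γ => m (r γ)), linForm_apply, Finset.sum_mul,
      ← Finset.sum_add_distrib]
    refine Finset.sum_congr rfl fun σ _ => ?_
    have hc : S.conjChar (r (S.rightHom σ)) = S.conjChar σ := by
      conv_rhs => rw [S.eq_mul_fiberIndex σ, S.conjChar_mul_inlAdd]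
    rw [map_mul, regularAction_regularVar, mul_one, hr, h, hc]
    simp only [mul_add, smul_mul_assoc, mul_smul_comm]

/-- An element of the field of invariant forms with trivial stabilizer. -/
theorem regularAction_sq_add_twistedForm_injective :
    Function.Injective (fun σ => regularAction K Γ σ (fiberForm S K 1 ^ 2 + twistedForm S K)) := by
  intro σ τ h
  simp only [map_add, map_pow, regularAction_fiberForm, mul_one] at h
  simp only [fiberForm, twistedForm, regularAction_linForm] at h
  -- The square puts the fibre sum in degree 2, apart from the twisted form: the former determines
  -- the image in G, even up to sign, and the latter then the kernel part.
  obtain ⟨h1, h2⟩ := linForm_sq_add_linForm_inj h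
  have hπ : S.rightHom σ = S.rightHom τ := by
    rcases h1 with h1 | h1
    · have := congrFun h1 σ
      by_contra hne
      simp [hne] at this
    · have := congrFun h1 σ
      by_contra hne
      simp [hne] at this
  obtain ⟨k, rfl⟩ := S.rightHom_eq_iff.mp hπ
  have h3 : regularAction K Γ σ (twistedForm S K) =
      regularAction K Γ (σ * S.inlAdd k) (twistedForm S K) := by
    simp only [twistedForm, regularAction_linForm, h2]
  rw [map_mul, AlgEquiv.mul_apply, EmbeddingLike.apply_eq_iff_eq,
    regularAction_inlAdd_twistedForm, eq_comm, sub_eq_self, smul_eq_zero] at h3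
  rcases h3 with h3 | h3
  · rw [map_eq_zero] at h3
    subst h3
    simp [GroupExtension.inlAdd]
  · exact absurd h3 (linForm_ne_zero 1 (by simp))

end InvariantForms

/-! ### Descent and counting of spanning vectors -/

section Selection

/-- Selection of few vectors from a spanning set, one vector being prescribed. -/
theorem exists_finset_subset_span_insert {E M : Type*} [Field E] [AddCommGroup M] [Module E M]
    {T : Set M} {W : Finset M} {v : M} (hv : v ≠ 0) (hvW : v ∈ Submodule.span E (W : Set M))
    (hT : T ⊆ Submodule.span E (W : Set M)) :
    ∃ T' : Finset M, ↑T' ⊆ T ∧ T'.card + 1 ≤ W.card ∧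
      T ⊆ Submodule.span E (insert v (T' : Set M)) := by
  classical
  obtain ⟨b, hbT, hvb, hTb, hb⟩ := exists_linearIndepOn_id_extension
    (K := E) (s := {v}) (t := insert v T) (LinearIndepOn.singleton hv)
    (Set.singleton_subset_iff.mpr (Set.mem_insert _ _))
  have hbW : b ⊆ Submodule.span E (W : Set M) := hbT.trans (Set.insert_subset hvW hT)
  have hfin : b.Finite := by
    have : LinearIndependent E
        (fun x : b => (⟨x.1, hbW x.2⟩ : Submodule.span E (W : Set M))) :=
      LinearIndependent.of_comp (Submodule.subtype _) hb
    have := this.finite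
    exact Set.toFinite b
  lift b to Finset M using hfin
  have hvb' : v ∈ b := by simpa using hvb
  refine ⟨b.erase v, ?_, ?_, ?_⟩
  · intro x hx
    rw [Finset.coe_erase] at hx
    exact (hbT hx.1).resolve_left hx.2
  · rw [Finset.card_erase_add_one hvb', ← finrank_span_finset_eq_card hb]
    exact (Submodule.finrank_mono (Submodule.span_le.mpr hbW)).trans (finrank_span_finset_le_card W)
  · rw [← Finset.coe_insert, Finset.insert_erase hvb']
    exact (Set.subset_insert _ _).trans hTb

variable {K Γ : Type*} [Field K] [Group Γ] [Fintype Γ]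

/-- Semilinear descent: invariant linear forms span all linear forms. -/
theorem regularVar_mem_span_traces (E : IntermediateField K (RegularFunctionField K Γ))
    (hE : ∀ σ, ∀ f ∈ E, regularAction K Γ σ f ∈ E) {a : RegularFunctionField K Γ} (ha : a ∈ E)
    (hinj : Function.Injective (fun σ => regularAction K Γ σ a)) (g : Γ) :
    regularVar K g ∈ Submodule.span E
      (Set.range fun j : ℕ => ∑ σ, regularAction K Γ σ (a ^ j * regularVar K 1)) := by
  classical
  let v : Γ → E := fun σ => ⟨regularAction K Γ σ a, hE σ a ha⟩
  have hv : Function.Injective v := fun σ τ h => hinj (congrArg Subtype.val h)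
  -- The translates of a are distinct, so interpolation gives coefficients for which the combination
  -- of traces collapses to the single variable x(g).
  obtain ⟨P, hP⟩ : ∃ P : Polynomial E, ∀ σ, P.eval (v σ) = if σ = g then 1 else 0 :=
    ⟨Lagrange.interpolate Finset.univ v (fun σ => if σ = g then 1 else 0), fun σ =>
      Lagrange.eval_interpolate_at_node _ hv.injOn (Finset.mem_univ σ)⟩
  have key : regularVar K g = ∑ j ∈ Finset.range (P.natDegree + 1),
      P.coeff j • ∑ σ, regularAction K Γ σ (a ^ j * regularVar K 1) := by
    simp only [Finset.smul_sum]
    rw [Finset.sum_comm]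
    have (σ : Γ) : ∑ j ∈ Finset.range (P.natDegree + 1),
        P.coeff j • regularAction K Γ σ (a ^ j * regularVar K 1) =
        (P.eval (v σ)) • regularVar K σ := by
      rw [Polynomial.eval_eq_sum_range, Finset.sum_smul]
      refine Finset.sum_congr rfl fun j _ => ?_
      rw [mul_smul, map_mul, map_pow, regularAction_regularVar, mul_one]
      rfl
    simp only [this, hP]
    simp
  rw [key]
  exact sum_mem fun j _ => Submodule.smul_mem _ _ (Submodule.subset_span ⟨j, rfl⟩)

variable {p : ℕ} [Fact p.Prime] [CharP K p] {G : Type*} [Group G] [Fintype G]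
  (S : GroupExtension (Multiplicative (ZMod p)) Γ G)

/-- Modulo the fibre sums and the twisted form, `|Γ| - |G| - 1` variables suffice. -/
theorem exists_spanning_finset (E : IntermediateField K (RegularFunctionField K Γ))
    (hy : ∀ γ, fiberForm S K γ ∈ E) (hu : twistedForm S K ∈ E) :
    ∃ W : Finset (RegularFunctionField K Γ), W.card + Fintype.card G ≤ Fintype.card Γ ∧
      1 ∈ Submodule.span E (W : Set (RegularFunctionField K Γ)) ∧
      ∀ g, regularVar K g ∈ Submodule.span E (W : Set (RegularFunctionField K Γ)) := by
  classical
  obtain ⟨g₀, hg₀, hi₀⟩ := S.exists_rightHom_fiberIndex 1 1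
  -- The twisted form does not involve the variables of index 0, so it yields x(g₀) from `R` alone;
  -- each fibre sum then yields the index 0 variable of its fibre.
  let R : Finset Γ := {g | S.fiberIndex g ≠ 0 ∧ g ≠ g₀}
  let W : Finset (RegularFunctionField K Γ) := insert 1 (R.image (regularVar K))
  have h1 : ∀ f ∈ E, f ∈ Submodule.span E (W : Set (RegularFunctionField K Γ)) := by
    intro f hf
    have : f = (⟨f, hf⟩ : E) • (1 : RegularFunctionField K Γ) := by simp [IntermediateField.smul_def]
    rw [this]
    exact Submodule.smul_mem _ _ (Submodule.subset_span (by simp [W]))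
  have hR : ∀ g ∈ R, regularVar K g ∈ Submodule.span E (W : Set (RegularFunctionField K Γ)) := by
    intro g hg
    refine Submodule.subset_span (Finset.mem_coe.mpr ?_)
    exact Finset.mem_insert_of_mem (Finset.mem_image_of_mem _ hg)
  have hK (r : K) {f : RegularFunctionField K Γ}
      (hf : f ∈ Submodule.span E (W : Set (RegularFunctionField K Γ))) :
      r • f ∈ Submodule.span E (W : Set (RegularFunctionField K Γ)) :=
    Submodule.smul_of_tower_mem _ r hf
  have hx₀ : regularVar K g₀ ∈ Submodule.span E (W : Set (RegularFunctionField K Γ)) := by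
    set e : K := ZMod.castHom dvd_rfl K (S.conjChar g₀ * S.fiberIndex g₀) with he
    have he0 : e ≠ 0 := by
      rw [he, hi₀, mul_one, Ne, map_eq_zero]
      exact S.conjChar_ne_zero g₀
    have h : twistedForm S K = e • regularVar K g₀ + ∑ g ∈ Finset.univ.erase g₀,
        ZMod.castHom dvd_rfl K (S.conjChar g * S.fiberIndex g) • regularVar K g := by
      rw [twistedForm, linForm_apply, ← Finset.add_sum_erase _ _ (Finset.mem_univ g₀)]
    have h' : regularVar K g₀ = e⁻¹ • (twistedForm S K - ∑ g ∈ Finset.univ.erase g₀,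
        ZMod.castHom dvd_rfl K (S.conjChar g * S.fiberIndex g) • regularVar K g) := by
      rw [h, add_sub_cancel_right, inv_smul_smul₀ he0]
    rw [h']
    refine hK _ (sub_mem (h1 _ hu) (sum_mem fun g hg => ?_))
    by_cases h0 : S.fiberIndex g = 0
    · rw [h0, mul_zero, map_zero, zero_smul]
      exact zero_mem _
    · exact hK _ (hR g (by simpa [R, h0] using hg))
  have hx : ∀ g, S.fiberIndex g ≠ 0 →
      regularVar K g ∈ Submodule.span E (W : Set (RegularFunctionField K Γ)) := by
    intro g hg
    by_cases h : g = g₀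
    · rw [h]
      exact hx₀
    · exact hR g (by simp [R, h, hg])
  refine ⟨W, ?_, h1 1 (one_mem _), fun g => ?_⟩
  · have hcard : Fintype.card G + 1 ≤ Rᶜ.card := by
      have hsub : insert g₀ ({g | S.fiberIndex g = 0} : Finset Γ) ⊆ Rᶜ := by
        intro g hg
        simp only [Finset.mem_insert, Finset.mem_filter, Finset.mem_univ, true_and] at hg
        simp only [R, Finset.mem_compl, Finset.mem_filter, Finset.mem_univ, true_and]
        tauto
      refine le_trans ?_ (Finset.card_le_card hsub)
      rw [Finset.card_insert_of_notMem (by simp [hi₀])]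
      refine Nat.add_le_add_right ?_ 1
      rw [← Finset.card_univ]
      refine Finset.card_le_card_of_surjOn S.rightHom fun γ _ => ?_
      obtain ⟨g, h1, h2⟩ := S.exists_rightHom_fiberIndex γ 0
      exact ⟨g, by simp [h2], h1⟩
    have hW : W.card ≤ R.card + 1 :=
      (Finset.card_insert_le _ _).trans (Nat.add_le_add_right Finset.card_image_le 1)
    have := Finset.card_add_card_compl R
    omega
  · by_cases hg : S.fiberIndex g = 0
    · have h : fiberForm S K (S.rightHom g) = regularVar K g + ∑ h ∈ Finset.univ.erase g,
          (if S.rightHom h = S.rightHom g then (1 : K) else 0) • regularVar K h := by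
        rw [fiberForm, linForm_apply, ← Finset.add_sum_erase _ _ (Finset.mem_univ g), if_pos rfl,
          one_smul]
      have h' := sub_eq_iff_eq_add.mpr h
      rw [← h']
      refine sub_mem (h1 _ (hy _)) (sum_mem fun h hh => ?_)
      split_ifs with hhg
      · refine hK _ (hx h fun h0 => ?_)
        exact (Finset.ne_of_mem_erase hh) (S.eq_of_rightHom_fiberIndex hhg (h0.trans hg.symm))
      · rw [zero_smul]
        exact zero_mem _
    · exact hx g hg

/-- The field of rational functions in the fibre sums and the twisted form. -/
noncomputable def twistedField : IntermediateField K (RegularFunctionField K Γ) :=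
  IntermediateField.adjoin K (insert (twistedForm S K) (Set.range (fiberForm S K)))

end Selection

/-! ### The embedding of function fields -/

section FiberHom

open MvPolynomial

variable {p : ℕ} {G Γ : Type*} [Group G] [Group Γ] [Fintype Γ]
  (S : GroupExtension (Multiplicative (ZMod p)) Γ G) (K : Type*) [Field K]

/-- A left inverse on polynomials keeps the index 0 variable of each fibre and kills the others. -/
theorem aeval_fiberForm_injective :
    Function.Injective (aeval (fiberForm S K) : MvPolynomial G K →ₐ[K] RegularFunctionField K Γ) := by
  classical
  let y : G → MvPolynomial Γ K := fun γ =>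
    polyLinForm K (fun g => if S.rightHom g = γ then 1 else 0)
  let ψ : MvPolynomial Γ K →ₐ[K] MvPolynomial G K :=
    aeval (fun g => if S.fiberIndex g = 0 then X (S.rightHom g) else 0)
  have hψ : Function.LeftInverse ψ (aeval y) := by
    have : ψ.comp (aeval y) = AlgHom.id K _ := by
      ext γ : 1
      obtain ⟨g₀, hπ, hi⟩ := S.exists_rightHom_fiberIndex γ 0
      simp only [AlgHom.comp_apply, aeval_X, y, polyLinForm, Fintype.linearCombination_apply,
        map_sum, map_smul, AlgHom.id_apply, ψ]
      rw [Finset.sum_eq_single g₀]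
      · simp [hπ, hi]
      · intro g _ hg
        by_cases h1 : S.rightHom g = γ
        · have h2 : S.fiberIndex g ≠ 0 := fun h2 =>
            hg (S.eq_of_rightHom_fiberIndex (h1.trans hπ.symm) (h2.trans hi.symm))
          rw [if_neg h2, smul_zero]
        · rw [if_neg h1, zero_smul]
      · simp
    exact fun f => DFunLike.congr_fun this f
  have h : (aeval (fiberForm S K) : MvPolynomial G K →ₐ[K] RegularFunctionField K Γ) =
      (IsScalarTower.toAlgHom K (MvPolynomial Γ K) _).comp (aeval y) := by
    ext γ : 1
    simp only [aeval_X, AlgHom.comp_apply, IsScalarTower.coe_toAlgHom', y, algebraMap_polyLinForm]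
    rw [fiberForm]
  rw [h]
  exact (IsFractionRing.injective _ _).comp hψ.injective

/-- The embedding of function fields sending each variable to the sum over its fibre. -/
noncomputable def fiberHom : RegularFunctionField K G →ₐ[K] RegularFunctionField K Γ :=
  IsFractionRing.liftAlgHom (aeval_fiberForm_injective S K)

variable {K}

@[simp] theorem fiberHom_regularVar (γ : G) :
    fiberHom S K (regularVar K γ) = fiberForm S K γ := by
  simp [fiberHom, regularVar]

theorem fiberHom_regularAction (σ : Γ) (f : RegularFunctionField K G) :
    fiberHom S K (regularAction K G (S.rightHom σ) f) = regularAction K Γ σ (fiberHom S K f) := by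
  have : (fiberHom S K).comp (regularAction K G (S.rightHom σ) : _ →ₐ[K] _) =
      (regularAction K Γ σ : _ →ₐ[K] _).comp (fiberHom S K) := by
    refine IsLocalization.algHom_ext (nonZeroDivisors (MvPolynomial G K)) ?_
    ext γ : 1
    change fiberHom S K (regularAction K G (S.rightHom σ) (regularVar K γ)) =
      regularAction K Γ σ (fiberHom S K (regularVar K γ))
    rw [regularAction_regularVar, fiberHom_regularVar, fiberHom_regularVar, regularAction_fiberForm]
  exact DFunLike.congr_fun this f

theorem fiberHom_mem_noetherField {f : RegularFunctionField K G} (hf : f ∈ noetherField K G) :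
    fiberHom S K f ∈ noetherField K Γ := by
  rw [mem_noetherField] at hf ⊢
  intro σ
  rw [← fiberHom_regularAction, hf]

theorem fiberField_le_fieldRange : fiberField S K ≤ (fiberHom S K).fieldRange := by
  refine IntermediateField.adjoin_le_iff.mpr ?_
  rintro _ ⟨γ, rfl⟩
  exact ⟨regularVar K γ, fiberHom_regularVar S γ⟩

variable (K) in
/-- The embedding of the fixed field of the quotient into the fixed field of the extension. -/
noncomputable def noetherFieldHom : noetherField K G →ₐ[K] noetherField K Γ :=
  ((fiberHom S K).comp (noetherField K G).val).codRestrict (noetherField K Γ).toSubalgebra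
    (fun f => fiberHom_mem_noetherField S f.2)

end FiberHom

/-! ### Degree bounds and generators of the fixed field -/

section Generation

open Polynomial in
/-- A root of `X ^ p + b X + c` generates an extension of degree at most `p`. -/
theorem finrank_adjoin_le_of_pow_add {F L : Type*} [Field F] [Field L] [Algebra F L] {p : ℕ}
    (hp : 1 < p) {u : L} {b c : F}
    (h : u ^ p + (algebraMap F L b * u + algebraMap F L c) = 0) :
    FiniteDimensional F (IntermediateField.adjoin F {u}) ∧
      Module.finrank F (IntermediateField.adjoin F {u}) ≤ p := by
  have hdeg : (C b * X + C c : F[X]).degree < p :=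
    degree_linear_le.trans_lt (by exact_mod_cast hp)
  have hmonic : (X ^ p + (C b * X + C c) : F[X]).Monic := monic_X_pow_add hdeg
  have hroot : aeval u (X ^ p + (C b * X + C c) : F[X]) = 0 := by simpa using h
  have hint : IsIntegral F u := ⟨_, hmonic, hroot⟩
  refine ⟨IntermediateField.adjoin.finiteDimensional hint, ?_⟩
  rw [IntermediateField.adjoin.finrank hint]
  refine natDegree_le_of_degree_le ((minpoly.min F u hmonic hroot).trans ?_)
  exact (degree_add_le _ _).trans (max_le (degree_X_pow_le _) hdeg.le)

/-- The composite of a field with the image of a finite extension. -/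
theorem exists_intermediateField_finrank_le {F M L : Type*} [Field F] [Field M] [Field L]
    [Algebra F M] [FiniteDimensional F M] (φ : M →+* L) (A : Subfield L)
    (hA : ∀ f : F, φ (algebraMap F M f) ∈ A) :
    ∃ A₁ : IntermediateField A L, (∀ f, φ f ∈ A₁) ∧
      FiniteDimensional A A₁ ∧ Module.finrank A A₁ ≤ Module.finrank F M := by
  let _ : Algebra M L := φ.toAlgebra
  let _ : Algebra F L := (φ.comp (algebraMap F M)).toAlgebra
  let _ : Algebra F A := ((φ.comp (algebraMap F M)).codRestrict A hA).toAlgebra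
  have : IsScalarTower F A L := IsScalarTower.of_algebraMap_eq (fun _ => rfl)
  have : IsScalarTower F M L := IsScalarTower.of_algebraMap_eq (fun _ => rfl)
  let e : M →ₐ[F] L := IsScalarTower.toAlgHom _ _ _
  let eL : M ≃ₐ[F] e.fieldRange := AlgEquiv.ofInjectiveField e
  have hL : FiniteDimensional F e.fieldRange := eL.toLinearEquiv.finiteDimensional
  have hr := IntermediateField.adjoin_rank_le_of_isAlgebraic_right A e.fieldRange
  rw [← Module.finrank_eq_rank F e.fieldRange, ← eL.toLinearEquiv.finrank_eq] at hr
  refine ⟨IntermediateField.adjoin A (e.fieldRange : Set L), fun f => ?_, ?_, ?_⟩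
  · exact IntermediateField.subset_adjoin _ _ ⟨f, rfl⟩
  · exact Module.rank_lt_aleph0_iff.mp (hr.trans_lt Cardinal.natCast_lt_aleph0)
  · exact Module.finrank_le_of_rank_le hr

/-- A degree criterion for equality of subfields. -/
theorem subfield_le_of_finrank_mul_le {F M L : Type*} [Field F] [Field M] [Field L]
    [Algebra F M] [FiniteDimensional F M] (φ : M →+* L) {A B : Subfield L} (hAB : A ≤ B)
    (hA : ∀ f : F, φ (algebraMap F M f) ∈ A) {p : ℕ} (hp : 1 < p) {u b c : L}
    (hb : b ∈ A ⊔ φ.fieldRange) (hc : c ∈ A ⊔ φ.fieldRange) (h : u ^ p + (b * u + c) = 0)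
    (htop : ∀ A' : Subfield L, A ⊔ φ.fieldRange ≤ A' → u ∈ A' → A' = ⊤)
    (hdeg : Module.finrank F M * p ≤ Module.finrank B L) : B ≤ A := by
  obtain ⟨A₁, hA₁, hfin₁, hcard₁⟩ := exists_intermediateField_finrank_le φ A hA
  have hle : A ⊔ φ.fieldRange ≤ A₁.toSubfield := by
    refine sup_le (fun x hx => A₁.algebraMap_mem ⟨x, hx⟩) ?_
    rintro _ ⟨f, rfl⟩
    exact hA₁ f
  obtain ⟨hfin₂, hcard₂⟩ := finrank_adjoin_le_of_pow_add (F := A₁) hp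
    (b := ⟨b, hle hb⟩) (c := ⟨c, hle hc⟩) h
  have h₂ : IntermediateField.adjoin A₁ {u} = ⊤ := by
    have := htop (IntermediateField.adjoin A₁ {u}).toSubfield
      (hle.trans fun x hx => IntermediateField.algebraMap_mem _ (⟨x, hx⟩ : A₁))
      (IntermediateField.subset_adjoin _ _ rfl)
    exact eq_top_iff.mpr fun f _ => this.ge (Subfield.mem_top f)
  rw [h₂] at hfin₂ hcard₂
  have hfin₃ : FiniteDimensional A₁ L := IntermediateField.topEquiv.toLinearEquiv.finiteDimensional
  rw [IntermediateField.finrank_top'] at hcard₂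
  have hfin : FiniteDimensional A L := FiniteDimensional.trans A A₁ L
  have hpos : 0 < Module.finrank A L := Module.finrank_pos
  have hAL : Module.finrank A L ≤ Module.finrank B L := by
    rw [← Module.finrank_mul_finrank A A₁ L]
    exact (Nat.mul_le_mul hcard₁ hcard₂).trans hdeg
  -- In the tower A ≤ B ≤ L the degree of B over A is at most 1; positivity excludes the default
  -- value 0 of an infinite degree.
  rw [← Subfield.relfinrank_mul_finrank_top hAB] at hpos hAL
  rw [← Subfield.relfinrank_eq_one_iff]
  have h0 := Nat.pos_of_mul_pos_right hpos
  have h1 := Nat.le_of_mul_le_mul_right (hAL.trans_eq (one_mul _).symm)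
    (Nat.pos_of_mul_pos_left hpos)
  omega

variable {p : ℕ} {G Γ : Type*} [Group G] [Group Γ] [Fintype Γ]
  (S : GroupExtension (Multiplicative (ZMod p)) Γ G) (K : Type*) [Field K]
  [CharP K p] [Fact p.Prime]

theorem regularAction_mem_twistedField (σ : Γ) {f : RegularFunctionField K Γ}
    (hf : f ∈ twistedField (K := K) S) : regularAction K Γ σ f ∈ twistedField (K := K) S := by
  have hle : fiberField S K ≤ twistedField S :=
    IntermediateField.adjoin.mono _ _ _ (Set.subset_insert _ _)
  have : twistedField (K := K) S ≤
      (twistedField S).comap (regularAction K Γ σ : _ →ₐ[K] _) := by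
    refine IntermediateField.adjoin_le_iff.mpr (Set.insert_subset ?_ ?_)
    · change regularAction K Γ σ _ ∈ twistedField S
      obtain ⟨m, hm, h⟩ := regularAction_twistedForm S (K := K) σ
      rw [h]
      exact add_mem (IntermediateField.smul_mem _
        (IntermediateField.subset_adjoin _ _ (Set.mem_insert _ _))) (hle hm)
    · rintro _ ⟨γ, rfl⟩
      exact hle (regularAction_mem_fiberField S σ (fiberForm_mem_fiberField S γ))
  exact this hf

/-- The fixed field of the extension is generated over that of the quotient by `|Γ| - |G|`
elements. -/
theorem exists_generators [Fintype G] :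
    ∃ T : Finset (RegularFunctionField K Γ), T.card + Fintype.card G ≤ Fintype.card Γ ∧
      (∀ t ∈ T, t ∈ noetherField K Γ) ∧
      ∀ A : Subfield (RegularFunctionField K Γ), A ≤ (noetherField K Γ).toSubfield →
        (∀ f ∈ noetherField K G, fiberHom S K f ∈ A) → (∀ t ∈ T, t ∈ A) →
        (noetherField K Γ).toSubfield ≤ A := by
  classical
  have hu : twistedForm S K ∈ twistedField S :=
    IntermediateField.subset_adjoin _ _ (Set.mem_insert _ _)
  have hy (γ : G) : fiberForm S K γ ∈ twistedField S :=
    IntermediateField.subset_adjoin _ _ (Set.mem_insert_of_mem _ ⟨γ, rfl⟩)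
  obtain ⟨W, hWcard, hW1, hW⟩ := exists_spanning_finset S (twistedField S) hy hu
  let a := fiberForm S K 1 ^ 2 + twistedForm S K
  have ha : a ∈ twistedField S := add_mem (pow_mem (hy 1) 2) hu
  let T₀ : Set (RegularFunctionField K Γ) :=
    Set.range fun j : ℕ => ∑ σ, regularAction K Γ σ (a ^ j * regularVar K 1)
  have hT₀W : T₀ ⊆ Submodule.span (twistedField (K := K) S)
      (W : Set (RegularFunctionField K Γ)) := by
    rintro _ ⟨j, rfl⟩
    refine sum_mem fun σ _ => ?_
    rw [map_mul, regularAction_regularVar]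
    exact Submodule.smul_mem _ (⟨regularAction K Γ σ (a ^ j), regularAction_mem_twistedField S K σ
      (pow_mem ha j)⟩ : twistedField (K := K) S) (hW _)
  obtain ⟨T, hT, hTcard, hspan⟩ := exists_finset_subset_span_insert one_ne_zero hW1 hT₀W
  -- The place saved by prescribing the vector 1 is taken by the trace form.
  refine ⟨insert (traceForm S K) T, ?_, ?_, ?_⟩
  · have := Finset.card_insert_le (traceForm S K) T
    omega
  · intro t ht
    rcases Finset.mem_insert.mp ht with rfl | ht
    · exact traceForm_mem S
    · obtain ⟨j, rfl⟩ := hT ht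
      exact sum_regularAction_mem _
  · intro A hAle hAG hAT
    set N := A ⊔ (fiberHom S K).toRingHom.fieldRange with hN
    have hAN : A ≤ N := le_sup_left
    have hfib : ∀ f ∈ fiberField S K, f ∈ N := by
      intro f hf
      obtain ⟨f, rfl⟩ := fiberField_le_fieldRange S hf
      exact (le_sup_right : _ ≤ N) ⟨f, rfl⟩
    have hK (r : K) : algebraMap K (RegularFunctionField K Γ) r ∈ N :=
      hfib _ ((fiberField S K).algebraMap_mem r)
    obtain ⟨α, hα, β, hβ, hα0, htr⟩ := exists_traceForm_eq S (K := K)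
    have htrA : traceForm S K ∈ N := hAN (hAT _ (Finset.mem_insert_self _ _))
    -- The equation for the twisted form u is u^p - s^(p-1) u = (t - β)/α, where s is `linForm K 1`
    -- and t the trace form.
    refine subfield_le_of_finrank_mul_le (F := noetherField K G) (fiberHom S K).toRingHom hAle
      (fun f => hAG f f.2) (Fact.out : p.Prime).one_lt (u := twistedForm S K)
      (b := -linForm K 1 ^ (p - 1)) (c := (β - traceForm S K) / α)
      (neg_mem (pow_mem (hfib _ (linForm_one_mem_fiberField S)) _))
      (div_mem (sub_mem (hfib _ hβ) htrA) (hfib _ hα)) ?_ ?_ ?_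
    · rw [htr, artinSchreierForm]
      field_simp
      ring
    · intro A' hNA' huA'
      have hE : (twistedField (K := K) S).toSubfield ≤ A' := by
        refine IntermediateField.adjoin_le_subfield _ _ ?_ (Set.insert_subset huA' ?_)
        · rintro _ ⟨r, rfl⟩
          exact hNA' (hK r)
        · rintro _ ⟨γ, rfl⟩
          exact hNA' (hfib _ (fiberForm_mem_fiberField S γ))
      have hspanA : ∀ f ∈ Submodule.span (twistedField (K := K) S)
          (insert 1 (T : Set (RegularFunctionField K Γ))), f ∈ A' := by
        intro f hf
        induction hf using Submodule.span_induction with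
        | mem x hx =>
          rcases hx with rfl | hx
          · exact one_mem _
          · exact hNA' (hAN (hAT _ (Finset.mem_insert_of_mem hx)))
        | zero => exact zero_mem _
        | add x y _ _ hx hy => exact add_mem hx hy
        | smul e x _ hx => exact mul_mem (hE e.2) hx
      have hle := IntermediateField.adjoin_le_subfield K
        (Set.range (regularVar K (Γ := Γ))) (K := A') ?_ ?_
      · rw [adjoin_regularVar] at hle
        exact eq_top_iff.mpr fun f _ => hle (Subfield.mem_top f)
      · rintro _ ⟨r, rfl⟩
        exact hNA' (hK r)
      · rintro _ ⟨g, rfl⟩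
        refine hspanA _ (Submodule.span_le.mpr hspan ?_)
        exact regularVar_mem_span_traces (twistedField S)
          (fun σ f hf => regularAction_mem_twistedField S K σ hf) ha
          (regularAction_sq_add_twistedForm_injective S) g
    · rw [finrank_noetherField, ← S.card_eq_mul]
      exact finrank_noetherField.ge

end Generation

/-! ### Transcendence degree and conclusion -/

section Rationality

/-- A field generated by at most as many elements as its transcendence degree is rational. -/
theorem isRationalExtension_of_card_le_trdeg {F L : Type*} [Field F] [Field L] [Algebra F L]
    (T : Finset L) (hT : IntermediateField.adjoin F (T : Set L) = ⊤)
    (hcard : (T.card : Cardinal) ≤ Algebra.trdeg F L) : IsRationalExtension F L := by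
  let x : Fin T.card → L := fun i => T.equivFin.symm i
  have hx : Set.range x = T := by
    ext t
    constructor
    · rintro ⟨i, rfl⟩
      exact (T.equivFin.symm i).2
    · intro ht
      exact ⟨T.equivFin ⟨t, ht⟩, by simp [x]⟩
  refine ⟨T.card, x, ?_, by rw [hx, hT]⟩
  have : Algebra.IsAlgebraic (Algebra.adjoin F (Set.range x)) L := by
    refine ⟨fun f => ?_⟩
    have hf : f ∈ IntermediateField.adjoin F (Set.range x) := by
      rw [hx, hT]
      exact IntermediateField.mem_top
    obtain ⟨r, hr, s, hs, rfl⟩ := IntermediateField.mem_adjoin_iff_div.mp hf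
    have key : ∀ r ∈ Algebra.adjoin F (Set.range x),
        IsAlgebraic (Algebra.adjoin F (Set.range x)) r :=
      fun r hr => isAlgebraic_algebraMap (A := L) (⟨r, hr⟩ : Algebra.adjoin F (Set.range x))
    rw [div_eq_mul_inv]
    exact (key r hr).mul (key s hs).inv
  refine (Algebra.IsAlgebraic.isTranscendenceBasis_of_lift_le_trdeg_of_finite F x ?_).1
  simpa using hcard

theorem natCast_le_trdeg_fieldRange {F M L : Type*} [Field F] [Field M] [Field L] [Algebra F M]
    [Algebra F L] (φ : M →ₐ[F] L) {m n t : ℕ} (hM : Algebra.trdeg F M = m)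
    (hL : Algebra.trdeg F L = n) (h : t + m ≤ n) :
    (t : Cardinal) ≤ Algebra.trdeg φ.fieldRange L := by
  have hadd := trdeg_add_eq F φ.fieldRange (A := L)
  have hr : Cardinal.lift (Algebra.trdeg F M) = Cardinal.lift (Algebra.trdeg F φ.fieldRange) :=
    (AlgEquiv.ofInjectiveField φ).lift_trdeg_eq
  rw [hM, Cardinal.lift_natCast, eq_comm, Cardinal.lift_eq_nat_iff] at hr
  rw [hr, hL] at hadd
  obtain ⟨k, hk⟩ := Cardinal.lt_aleph0.mp
    ((le_add_self.trans_eq hadd).trans_lt Cardinal.natCast_lt_aleph0)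
  rw [hk] at hadd ⊢
  norm_cast at hadd ⊢
  omega

theorem trdeg_noetherField {K Γ : Type*} [Field K] [Group Γ] [Finite Γ] :
    Algebra.trdeg K (noetherField K Γ) = Nat.card Γ := by
  have h := trdeg_add_eq K (noetherField K Γ) (A := RegularFunctionField K Γ)
  have h0 : Algebra.trdeg (noetherField K Γ) (RegularFunctionField K Γ) = 0 :=
    trdeg_eq_zero_iff.mpr inferInstance
  rwa [h0, add_zero, trdeg_regularFunctionField] at h

end Rationality

theorem theorem1p6 (K : Type*) [Field K] (p : ℕ) [CharP K p] (hp : 0 < p)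
    (G Gt : Type*) [Group G] [Finite G] [Group Gt]
    (S : GroupExtension (Multiplicative (ZMod p)) Gt G) :
    ∃ φ : noetherField K G →ₐ[K] noetherField K Gt,
      IsRationalExtension φ.fieldRange (noetherField K Gt) := by
  classical
  have : NeZero p := ⟨hp.ne'⟩
  have : Fact p.Prime := ⟨(CharP.char_is_prime_or_zero K p).resolve_right hp.ne'⟩
  have hinj : Function.Injective (fun g => (S.rightHom g, S.fiberIndex g)) := fun g h e =>
    S.eq_of_rightHom_fiberIndex (Prod.ext_iff.mp e).1 (Prod.ext_iff.mp e).2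
  have : Finite Gt := Finite.of_injective _ hinj
  have := Fintype.ofFinite G
  have := Fintype.ofFinite Gt
  obtain ⟨T, hcard, hTmem, hgen⟩ := exists_generators S K
  refine ⟨noetherFieldHom S K, ?_⟩
  set φ := noetherFieldHom S K with hφ
  refine isRationalExtension_of_card_le_trdeg (T.subtype (· ∈ noetherField K Gt)) ?_ ?_
  · let B := IntermediateField.adjoin φ.fieldRange
      ((T.subtype (· ∈ noetherField K Gt) : Finset _) : Set (noetherField K Gt))
    let ι : noetherField K Gt →+* RegularFunctionField K Gt := algebraMap _ _
    -- The generation criterion concerns subfields of the function field, so B is transported there.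
    have h := hgen (B.toSubfield.map ι) ?_ ?_ ?_
    · rw [eq_top_iff]
      intro f _
      obtain ⟨f', hf', e⟩ := h f.2
      rwa [← Subtype.ext e]
    · rintro _ ⟨f, -, rfl⟩
      exact f.2
    · intro f hf
      exact ⟨φ ⟨f, hf⟩, B.algebraMap_mem ⟨φ ⟨f, hf⟩, ⟨f, hf⟩, rfl⟩, rfl⟩
    · intro t ht
      exact ⟨⟨t, hTmem t ht⟩, IntermediateField.subset_adjoin _ _ (by simpa using ht), rfl⟩
  · have hT : (T.subtype (· ∈ noetherField K Gt)).card ≤ T.card := by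
      rw [Finset.card_subtype]
      exact Finset.card_filter_le _ _
    rw [← Nat.card_eq_fintype_card, ← Nat.card_eq_fintype_card] at hcard
    exact natCast_le_trdeg_fieldRange φ trdeg_noetherField trdeg_noetherField (by omega)
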